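/- For every integer $k\ge 2$, the problems $\widehat{\mathsf{WF}}$ and $\widehat{\mathsf{HPC}(k)}$ are strongly Weihrauch equivalent: $\widehat{\mathsf{WF}}\equiv_{\mathrm{sW}}\widehat{\mathsf{HPC}(k)}$. Here: (i) $\mathsf{WF}$ takes as input a tree $T\subseteq\mathbb N^{<\mathbb N}$ (a set of finite sequences closed under initial segments, given by its characteristic function) and outputs $1$ if $T$ has no infinite path and $0$ otherwise. (ii) $\mathsf{HPC}(k)$ takes as input a hypergraph $H=(V,E)$ with vertex set $V\subseteq\mathbb N$ and a countable set $E$ of edges, each an arbitrary (possibly infinite) subset of $V$, given by the characteristic function of $V$ and an enumeration of $E$ by characteristic functions. It outputs $1$ if there is a coloring $f:V\to\{0,\dots,k-1\}$ such that every edge with at least two vertices contains two vertices of different colors, and $0$ otherwise. (iii) For a problem (partial multi-valued function) $f:\subseteq X\rightrightarrows Y$ between represented spaces, the parallelization $\widehat f:\subseteq X^{\mathbb N}\rightrightarrows Y^{\mathbb N}$ maps $(x_i)_{i\in\mathbb N}$ to the set of all $(y_i)_{i\in\mathbb N}$ with $y_i\in f(x_i)$ for every $i$. (iv) A realizer of $f$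 is a partial function on $\mathbb N^{\mathbb N}$ that maps every name of every $x\in\operatorname{dom} f$ to a name of some $y\in f(x)$. One writes $f\le_{\mathrm{sW}}g$ if there are computable partial functions $K,H$ on $\mathbb N^{\mathbb N}$ such that $K\circ G\circ H$ is a realizer of $f$ for every realizer $G$ of $g$, and $f\equiv_{\mathrm{sW}}g$ if $f\le_{\mathrm{sW}}g$ and $g\le_{\mathrm{sW}}f$. -/

import Mathlib

namespace Weihrauch

/-! ### Computable functionals on Baire space -/

/-- Baire space, whose points serve as names of mathematical objects. -/
abbrev Baire : Type := ℕ → ℕ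

/-- The finite initial segment `⟨p 0, …, p (m - 1)⟩` of `p`. -/
def initSeg (p : Baire) (m : ℕ) : List ℕ := (List.range m).map p

/-- A partial function on Baire space is computable if one algorithm, run on finite initial segments
of the input `p`, produces the output sequence digit by digit: on an initial segment of `p` and a
position `n` the algorithm `g` either has no answer yet (`none`) or gives the correct digit, and for
each `n` some initial segment of `p` is long enough to get the answer. As usual, nothing is required
of the algorithm on inputs outside the domain of `F`. -/
def IsComputable (F : Baire →. Baire) : Prop :=
  ∃ g : List ℕ → ℕ → Option ℕ, Computable₂ g ∧
    ∀ p q : Baire, q ∈ F p → ∀ n : ℕ,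
      (∃ m : ℕ, g (initSeg p m) n = some (q n)) ∧
      ∀ m y : ℕ, g (initSeg p m) n = some y → y = q n

/-! ### Represented spaces -/

/-- A representation of `X`: a partial surjection from Baire space onto `X`, given by its graph
(`IsName p x` means that `p` is a name of `x`). -/
class Represented (X : Type*) where
  /-- `IsName p x`: the sequence `p` is a name of `x`. -/
  IsName : Baire → X → Prop
  unique : ∀ p x y, IsName p x → IsName p y → x = y
  exists_name : ∀ x, ∃ p, IsName p x

/-- A natural number is named by the sequences whose first entry is that number. -/
instance : Represented ℕ where
  IsName p n := p 0 = n
  unique := by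
    intro p x y hx hy
    exact hx.symm.trans hy
  exists_name n := ⟨fun _ => n, rfl⟩

/-- A name of a sequence of points is a sequence of names `⟨p₀, p₁, …⟩`, coded as one element of
Baire space through the pairing function. -/
instance {X : Type*} [Represented X] : Represented (ℕ → X) where
  IsName p x := ∀ i, Represented.IsName (fun n => p (Nat.pair i n)) (x i)
  unique := by
    intro p x y hx hy
    funext i
    exact Represented.unique _ _ _ (hx i) (hy i)
  exists_name x := by
    choose q hq using fun i => Represented.exists_name (x i)
    refine ⟨fun c => q c.unpair.1 c.unpair.2, fun i => ?_⟩
    simpa using hq i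

/-! ### Problems and strong Weihrauch reducibility -/

/-- A partial function `F` on Baire space realizes the problem (partial multi-valued function)
`f : X ⇉ Y` with domain `{x | (f x).Nonempty}` if it maps every name of an `x` in the domain to a
name of some `y ∈ f x`. -/
def Realizes {X Y : Type*} [Represented X] [Represented Y]
    (F : Baire →. Baire) (f : X → Set Y) : Prop :=
  ∀ (p : Baire) (x : X), Represented.IsName p x → (f x).Nonempty →
    ∃ q ∈ F p, ∃ y ∈ f x, Represented.IsName q y

/-- Strong Weihrauch reducibility: there are computable partial functions `K` and `H` on Baire space
such that `K ∘ G ∘ H` realizes `f` whenever `G` realizes `g`. -/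
def StrongReducible {X Y Z W : Type*} [Represented X] [Represented Y] [Represented Z]
    [Represented W] (f : X → Set Y) (g : Z → Set W) : Prop :=
  ∃ K H : Baire →. Baire, IsComputable K ∧ IsComputable H ∧
    ∀ G : Baire →. Baire, Realizes G g → Realizes (K.comp (G.comp H)) f

/-- Strong Weihrauch equivalence. -/
def StrongEquiv {X Y Z W : Type*} [Represented X] [Represented Y] [Represented Z]
    [Represented W] (f : X → Set Y) (g : Z → Set W) : Prop :=
  StrongReducible f g ∧ StrongReducible g f

/-- The (infinite) parallelization of a problem: it solves countably many instances at once. -/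
def parallelization {X Y : Type*} (f : X → Set Y) : (ℕ → X) → Set (ℕ → Y) :=
  fun x => {y | ∀ i, y i ∈ f (x i)}

/-! ### Trees and the problem `WF` -/

open Classical in
/-- The sequence `p`, read off at the indices `c a`, is the characteristic function of `A`. -/
def IsCharFun {α : Type*} (p : Baire) (c : α → ℕ) (A : Set α) : Prop :=
  ∀ a, p (c a) = if a ∈ A then 1 else 0

theorem IsCharFun.unique {α : Type*} {p : Baire} {c : α → ℕ} {A B : Set α}
    (hA : IsCharFun p c A) (hB : IsCharFun p c B) : A = B := by
  classical
  ext a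
  have h := (hA a).symm.trans (hB a)
  by_cases h1 : a ∈ A <;> by_cases h2 : a ∈ B <;> simp_all

/-- Trees of finite sequences of natural numbers. -/
abbrev Tree : Type := Descriptive.tree ℕ

/-- `f` is an infinite path through `T`: all its finite initial segments lie in `T`. -/
def IsPath (T : Tree) (f : ℕ → ℕ) : Prop := ∀ n, initSeg f n ∈ T

/-- A tree is well-founded if it has no infinite path. -/
def NoInfinitePath (T : Tree) : Prop := ¬ ∃ f : ℕ → ℕ, IsPath T f

/-- A tree is named by its characteristic function, via the coding of finite sequences by natural
numbers. -/
instance : Represented Tree where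
  IsName p T := IsCharFun p (Encodable.encode : List ℕ → ℕ) (T : Set (List ℕ))
  unique := by
    intro p S T hS hT
    exact SetLike.coe_injective (IsCharFun.unique hS hT)
  exists_name T := by
    classical
    refine ⟨fun c => if ∃ σ ∈ T, Encodable.encode σ = c then 1 else 0, fun σ => ?_⟩
    simp

open Classical in
/-- The problem `WF`: given a tree, output `1` if it is well-founded and `0` otherwise. -/
noncomputable def WF : Tree → Set ℕ :=
  fun T => {if NoInfinitePath T then 1 else 0}

/-! ### Hypergraphs and the problem `HPC k` -/

/-- Hypergraphs whose vertices are (coded by) natural numbers, with countably many edges; edges are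
arbitrary, possibly infinite, sets of vertices. -/
abbrev CountableHypergraph : Type := {H : Hypergraph ℕ // H.edgeSet.Countable}

/-- `f` is a proper coloring of `H`: each edge with at least two vertices contains vertices of
different colors. -/
def IsProperColoring (H : Hypergraph ℕ) {k : ℕ} (f : H.vertexSet → Fin k) : Prop :=
  ∀ e ∈ H.edgeSet, e.Nontrivial → ∃ u v : H.vertexSet, (u : ℕ) ∈ e ∧ (v : ℕ) ∈ e ∧ f u ≠ f v

/-- A name of a hypergraph codes (the characteristic functions of) its vertex set, a set `J` of edge
indices, and a sequence `e 0, e 1, …` of sets such that the `e j` with `j ∈ J` are the edges. The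
index set makes room for hypergraphs with finitely many, or no, edges. -/
instance : Represented CountableHypergraph where
  IsName p H := ∃ (J : Set ℕ) (e : ℕ → Set ℕ),
    IsCharFun p (fun v => Nat.pair 0 v) H.1.vertexSet ∧
    IsCharFun p (fun j => Nat.pair 1 j) J ∧
    (∀ j, IsCharFun p (fun v => Nat.pair (j + 2) v) (e j)) ∧
    H.1.edgeSet = e '' J
  unique := by
    rintro p H H' ⟨J, e, hV, hJ, he, hE⟩ ⟨J', e', hV', hJ', he', hE'⟩
    have h1 : J = J' := hJ.unique hJ'
    have h2 : e = e' := funext fun j => (he j).unique (he' j)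
    subst h1 h2
    exact Subtype.ext (Hypergraph.ext (hV.unique hV') (hE.trans hE'.symm))
  exists_name H := by
    classical
    obtain ⟨J, e, hE⟩ : ∃ (J : Set ℕ) (e : ℕ → Set ℕ), H.1.edgeSet = e '' J := by
      rcases H.1.edgeSet.eq_empty_or_nonempty with h | h
      · exact ⟨∅, fun _ => ∅, by simp [h]⟩
      · obtain ⟨e, he⟩ := H.2.exists_eq_range h
        exact ⟨Set.univ, e, by simp [he]⟩
    refine ⟨fun c =>
      if c.unpair.1 = 0 then (if c.unpair.2 ∈ H.1.vertexSet then 1 else 0)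
      else if c.unpair.1 = 1 then (if c.unpair.2 ∈ J then 1 else 0)
      else (if c.unpair.2 ∈ e (c.unpair.1 - 2) then 1 else 0), J, e, ?_, ?_, ?_, hE⟩
    · intro v; simp
    · intro j; simp
    · intro j v; simp

open Classical in
/-- The problem `HPC k`: given a hypergraph, output `1` if it has a proper `k`-coloring and `0`
otherwise. -/
noncomputable def HPC (k : ℕ) : CountableHypergraph → Set ℕ :=
  fun H => {if ∃ f : H.1.vertexSet → Fin k, IsProperColoring H.1 f then 1 else 0}

end Weihrauch

/-!
Already the single problems are equivalent, since having a path and being `k`-colorable, for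
`k ≥ 2`, are both `Σ¹₁`-complete; the outer functional negates the answer. A hypergraph is
`k`-colorable if and only if the tree of finite attempts at a coloring has a path, where an attempt
also contains, for each vertex of an edge, a vertex of that edge in another color: it is this
witness that makes the failure of an attempt visible in a finite part of the name. Conversely, the
existence of a path through `T` is a set of clauses saying that if `σ` lies on the path, then so
does one of its children in `T`. The clause of `σ` is one possibly infinite edge, as in the usual
reduction of satisfiability to 2-coloring; surplus colors are used up by vertices adjacent to all
others. Parallelization preserves strong reductions because a computable functional can be applied
to all components of a name.
-/

namespace Weihrauch

open Encodable

/-! ### Strong reductions and parallelization -/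

theorem initSeg_length (p : Baire) (m : ℕ) : (initSeg p m).length = m := by
  simp [initSeg]

theorem initSeg_succ (p : Baire) (m : ℕ) : initSeg p (m + 1) = initSeg p m ++ [p m] := by
  simp [initSeg, List.range_succ]

theorem getElem?_initSeg_eq_some {p : Baire} {m i y : ℕ} :
    (initSeg p m)[i]? = some y ↔ i < m ∧ p i = y := by
  simp only [initSeg, List.getElem?_map, Option.map_eq_some_iff, List.getElem?_eq_some_iff,
    List.length_range, List.getElem_range]
  grind

theorem getD_initSeg (p : Baire) {m i : ℕ} (h : i < m) : (initSeg p m).getD i 0 = p i := by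
  simp [initSeg, h]

theorem take_initSeg (p : Baire) {i m : ℕ} (h : i ≤ m) : (initSeg p m).take i = initSeg p i := by
  simp [initSeg, ← List.map_take, List.take_range, h]

theorem isComputable_of_use {G : List ℕ → ℕ → ℕ} {u : ℕ → ℕ} (hG : Computable₂ G)
    (hu : Computable u) : IsComputable fun p => Part.some fun n => G (initSeg p (u n)) n := by
  refine ⟨fun l n => bif decide (u n ≤ l.length) then some (G (l.take (u n)) n) else none, ?_, ?_⟩
  · have hun : Computable fun x : List ℕ × ℕ => u x.2 := hu.comp Computable.snd
    have hle : Computable fun x : List ℕ × ℕ => decide (u x.2 ≤ x.1.length) :=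
      Primrec.nat_le.decide.to_comp.comp hun (Computable.list_length.comp Computable.fst)
    exact hle.cond (Computable.option_some.comp
      (hG.comp (Primrec.list_take.to_comp.comp hun Computable.fst) Computable.snd))
      (Computable.const none)
  · intro p q hq n
    obtain rfl := Part.mem_some_iff.1 hq
    refine ⟨⟨u n, by simp [initSeg_length, take_initSeg]⟩, fun m y h => ?_⟩
    by_cases hm : u n ≤ m
    · simpa [initSeg_length, take_initSeg, hm, eq_comm] using h
    · simp [initSeg_length, hm] at h

/-- The `i`-th name in the sequence of names coded by `p`. -/
def component (i : ℕ) (p : Baire) : Baire := fun n => p (Nat.pair i n)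

/-- The code of a sequence of names. -/
def ofComponents (r : ℕ → Baire) : Baire := fun c => r c.unpair.1 c.unpair.2

theorem component_ofComponents (r : ℕ → Baire) (i : ℕ) : component i (ofComponents r) = r i := by
  ext n
  simp [component, ofComponents]

theorem ofComponents_component (p : Baire) : ofComponents (fun i => component i p) = p := by
  ext c
  simp [component, ofComponents]

/-- The functional that applies `F` to every name in a coded sequence; it is defined where all
these applications are. -/
def sequencewise (F : Baire →. Baire) : Baire →. Baire := fun p =>
  ⟨∀ i, (F (component i p)).Dom, fun h => ofComponents fun i => (F (component i p)).get (h i)⟩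

theorem mem_sequencewise {F : Baire →. Baire} {p q : Baire} :
    q ∈ sequencewise F p ↔ ∀ i, component i q ∈ F (component i p) := by
  constructor
  · rintro ⟨h, rfl⟩ i
    change component i (ofComponents fun i => (F (component i p)).get (h i)) ∈ _
    rw [component_ofComponents]
    exact Part.get_mem (h i)
  · intro h
    choose hdom hget using h
    exact ⟨hdom, (congrArg ofComponents (funext hget)).trans (ofComponents_component q)⟩

theorem IsComputable.sequencewise {F : Baire →. Baire} (hF : IsComputable F) :
    IsComputable (sequencewise F) := by
  obtain ⟨g, hg, hgF⟩ := hF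
  -- An input of length `⟨i, m⟩` contains the first `m` digits of its `i`-th member, so it suffices
  -- to compute digits of the `i`-th output from inputs of such lengths.
  let segment (i : ℕ) (l : List ℕ) : List ℕ :=
    (List.range l.length.unpair.2).map fun j => l.getD (Nat.pair i j) 0
  have segment_initSeg (p : Baire) (i m : ℕ) :
      segment i (initSeg p (Nat.pair i m)) = initSeg (component i p) m := by
    simp only [segment, initSeg_length, Nat.unpair_pair]
    exact List.map_congr_left fun j hj =>
      getD_initSeg p (Nat.pair_lt_pair_right i (List.mem_range.1 hj))
  have hsegment : Computable₂ segment := by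
    refine Primrec.to_comp (Primrec.list_map (Primrec.list_range.comp (Primrec.snd.comp
      (Primrec.unpair.comp (Primrec.list_length.comp Primrec.snd)))) ?_)
    exact (Primrec.list_getD 0).comp (Primrec.snd.comp Primrec.fst)
      (Primrec₂.natPair.comp (Primrec.fst.comp Primrec.fst) Primrec.snd)
  refine ⟨fun l n => bif decide (l.length.unpair.1 = n.unpair.1) then
    g (segment n.unpair.1 l) n.unpair.2 else none, ?_, fun p q hq n => ?_⟩
  · have hi : Computable fun x : List ℕ × ℕ => x.2.unpair.1 :=
      Computable.fst.comp (Computable.unpair.comp Computable.snd)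
    have hlen : Computable fun x : List ℕ × ℕ => x.1.length.unpair.1 :=
      Computable.fst.comp (Computable.unpair.comp (Computable.list_length.comp Computable.fst))
    exact (Primrec.eq.decide.to_comp.comp hlen hi).cond
      (hg.comp (hsegment.comp hi Computable.fst)
        (Computable.snd.comp (Computable.unpair.comp Computable.snd)))
      (Computable.const none)
  · obtain ⟨hex, huniq⟩ := hgF _ _ (mem_sequencewise.1 hq n.unpair.1) n.unpair.2
    have hqn : component n.unpair.1 q n.unpair.2 = q n := by simp [component]
    rw [hqn] at hex huniq
    refine ⟨hex.imp' (Nat.pair n.unpair.1) fun m hm => ?_, fun m y h => ?_⟩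
    · simpa [initSeg_length, segment_initSeg] using hm
    · simp only [initSeg_length] at h
      by_cases hm : m.unpair.1 = n.unpair.1
      · rw [← Nat.pair_unpair m, hm, segment_initSeg] at h
        exact huniq _ _ (by simpa using h)
      · simp [hm] at h

theorem isName_iff_component {X : Type*} [Represented X] {p : Baire} {x : ℕ → X} :
    Represented.IsName p x ↔ ∀ i, Represented.IsName (component i p) (x i) :=
  Iff.rfl

theorem isName_ofComponents {X : Type*} [Represented X] {r : ℕ → Baire} {x : ℕ → X}
    (h : ∀ i, Represented.IsName (r i) (x i)) : Represented.IsName (ofComponents r) x := by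
  simpa only [isName_iff_component, component_ofComponents] using h

theorem parallelization_nonempty {X Y : Type*} {f : X → Set Y} {x : ℕ → X} :
    (parallelization f x).Nonempty ↔ ∀ i, (f (x i)).Nonempty :=
  ⟨fun ⟨y, hy⟩ i => ⟨y i, hy i⟩, fun h => ⟨fun i => (h i).choose, fun i => (h i).choose_spec⟩⟩

section StrongReducible

variable {X Y Z W : Type*} [Represented X] [Represented Y] [Represented Z] [Represented W]

theorem exists_realizes (g : Z → Set W) : ∃ G : Baire →. Baire, Realizes G g ∧
    ∀ r, (G r).Dom → ∃ z, Represented.IsName r z ∧ (g z).Nonempty := by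
  classical
  let solves (r q : Baire) : Prop :=
    ∃ z, Represented.IsName r z ∧ ∃ w ∈ g z, Represented.IsName q w
  refine ⟨fun r => ⟨∃ q, solves r q, fun h => h.choose⟩, fun r z hr ⟨w, hw⟩ => ?_, ?_⟩
  · obtain ⟨q, hq⟩ := Represented.exists_name w
    have hsol : ∃ q, solves r q := ⟨q, z, hr, w, hw, hq⟩
    obtain ⟨z', hz', hw'⟩ := hsol.choose_spec
    obtain rfl := Represented.unique r z z' hr hz'
    exact ⟨_, Part.get_mem hsol, hw'⟩
  · rintro r ⟨q, z, hr, w, hw, -⟩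
    exact ⟨z, hr, w, hw⟩

open Classical in
theorem Realizes.override {G : Baire →. Baire} {g : Z → Set W} (hG : Realizes G g) {r q : Baire}
    {z : Z} {w : W} (hr : Represented.IsName r z) (hw : w ∈ g z) (hq : Represented.IsName q w) :
    Realizes (fun r' => if r' = r then Part.some q else G r') g := by
  intro r' z' hr' hz'
  obtain rfl | hne := eq_or_ne r' r
  · obtain rfl := Represented.unique r' z z' hr hr'
    exact ⟨q, by simp, w, hw, hq⟩
  · simpa only [if_neg hne] using hG r' z' hr' hz'

-- A realizer can be undefined off the names of instances, and its value at a single name can be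
-- any name of any solution; so `H` must produce names of instances, and `K` handle all solutions.
theorem strongReducible_iff {f : X → Set Y} {g : Z → Set W} :
    StrongReducible f g ↔ ∃ K H : Baire →. Baire, IsComputable K ∧ IsComputable H ∧
      ∀ p x, Represented.IsName p x → (f x).Nonempty →
        ∃ r ∈ H p, ∃ z, Represented.IsName r z ∧ (g z).Nonempty ∧
          ∀ q, ∀ w ∈ g z, Represented.IsName q w →
            ∃ s ∈ K q, ∃ y ∈ f x, Represented.IsName s y := by
  classical
  refine exists₂_congr fun K H => and_congr_right fun _ => and_congr_right fun _ =>
    ⟨fun h p x hp hx => ?_, fun h G hG p x hp hx => ?_⟩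
  · obtain ⟨G, hG, hdom⟩ := exists_realizes g
    obtain ⟨s, hs, -⟩ := h G hG p x hp hx
    obtain ⟨q, hq, -⟩ := Part.mem_bind_iff.1 hs
    obtain ⟨r, hr, hqr⟩ := Part.mem_bind_iff.1 hq
    obtain ⟨z, hz, hgz⟩ := hdom r hqr.1
    refine ⟨r, hr, z, hz, hgz, fun q w hw hqw => ?_⟩
    obtain ⟨s, hs, hsy⟩ := h _ (hG.override hz hw hqw) p x hp hx
    obtain ⟨q', hq', hsq'⟩ := Part.mem_bind_iff.1 hs
    obtain ⟨r', hr', hqr'⟩ := Part.mem_bind_iff.1 hq'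
    obtain rfl := Part.mem_unique hr hr'
    obtain rfl : q' = q := by simpa using hqr'
    exact ⟨s, hsq', hsy⟩
  · obtain ⟨r, hr, z, hz, hgz, hK⟩ := h p x hp hx
    obtain ⟨q, hq, w, hw, hqw⟩ := hG r z hz hgz
    obtain ⟨s, hs, hsy⟩ := hK q w hw hqw
    exact ⟨s, Part.mem_bind (Part.mem_bind hr hq) hs, hsy⟩

theorem StrongReducible.parallelization {f : X → Set Y} {g : Z → Set W}
    (h : StrongReducible f g) : StrongReducible (parallelization f) (parallelization g) := by
  obtain ⟨K, H, hK, hH, hfg⟩ := strongReducible_iff.1 h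
  refine strongReducible_iff.2 ⟨_, _, hK.sequencewise, hH.sequencewise, fun p x hp hx => ?_⟩
  choose r hr z hz hgz hKs using fun i =>
    hfg _ _ (isName_iff_component.1 hp i) (parallelization_nonempty.1 hx i)
  refine ⟨ofComponents r, mem_sequencewise.2 ?_, z, isName_ofComponents hz,
    parallelization_nonempty.2 hgz, fun q w hw hq => ?_⟩
  · simpa only [component_ofComponents] using hr
  · choose s hs y hy hsy using fun i => hKs i _ _ (hw i) (isName_iff_component.1 hq i)
    refine ⟨ofComponents s, mem_sequencewise.2 ?_, y, hy, isName_ofComponents hsy⟩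
    simpa only [component_ofComponents] using hs

theorem StrongEquiv.parallelization {f : X → Set Y} {g : Z → Set W} (h : StrongEquiv f g) :
    StrongEquiv (parallelization f) (parallelization g) :=
  ⟨h.1.parallelization, h.2.parallelization⟩

end StrongReducible

/-! ### From colorability to well-foundedness -/

theorem primrecPred_forall_lt {α : Type*} [Primcodable α] {f : α → ℕ} {S : α → ℕ → Prop}
    (hf : Primrec f) (hS : PrimrecRel S) : PrimrecPred fun a => ∀ m < f a, S a m :=
  (hS.swap.forall_mem_list.comp (Primrec.list_range.comp hf) Primrec.id).of_eq fun a => by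
    simp [Function.swap]

theorem primrecPred_imp {α : Type*} [Primcodable α] {P Q : α → Prop} (hP : PrimrecPred P)
    (hQ : PrimrecPred Q) : PrimrecPred fun a => P a → Q a :=
  (hP.not.or hQ).of_eq fun _ => imp_iff_not_or.symm

theorem IsCharFun.eq_one_iff {α : Type*} {p : Baire} {c : α → ℕ} {A : Set α}
    (h : IsCharFun p c A) (a : α) : p (c a) = 1 ↔ a ∈ A := by
  simp [h a]

open Classical in
/-- The functional whose `n`-th digit is the truth value of `D` at the first `u n` digits of the
input and `n`. -/
noncomputable def decideOnInitSeg (D : List ℕ → ℕ → Prop) (u : ℕ → ℕ) (p : Baire) : Baire :=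
  fun n => if D (initSeg p (u n)) n then 1 else 0

theorem isComputable_decideOnInitSeg {D : List ℕ → ℕ → Prop} {u : ℕ → ℕ} (hD : PrimrecRel D)
    (hu : Primrec u) : IsComputable (decideOnInitSeg D u : Baire →. Baire) := by
  classical
  exact isComputable_of_use (G := fun l n => if D l n then 1 else 0)
    (Primrec.ite hD (Primrec.const 1) (Primrec.const 0)).to_comp hu.to_comp

theorem isCharFun_decideOnInitSeg {α : Type*} {D : List ℕ → ℕ → Prop} {u : ℕ → ℕ} {p : Baire}
    {c : α → ℕ} {A : Set α} (h : ∀ a, D (initSeg p (u (c a))) (c a) ↔ a ∈ A) :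
    IsCharFun (decideOnInitSeg D u p) c A := by
  classical
  exact fun a => if_congr (h a) rfl rfl

open Classical in
/-- The problem of deciding `P`: output `1` if `P x` holds and `0` otherwise. Both `WF` and `HPC k`
are of this form. -/
noncomputable def decisionProblem {X : Type*} (P : X → Prop) : X → Set ℕ :=
  fun x => {if P x then 1 else 0}

theorem isComputable_negate : IsComputable fun q => Part.some fun _ => 1 - q 0 := by
  have h := isComputable_of_use (G := fun l _ => 1 - l.getD 0 0) (u := fun _ => 1)
    (Primrec.nat_sub.comp (Primrec.const 1)
      ((Primrec.list_getD 0).comp Primrec.fst (Primrec.const 0))).to_comp (Computable.const 1)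
  simpa only [getD_initSeg _ Nat.zero_lt_one] using h

theorem strongReducible_decisionProblem_of_iff_not {X Z : Type*} [Represented X] [Represented Z]
    {P : X → Prop} {Q : Z → Prop} {F : Baire → Baire} (hF : IsComputable (F : Baire →. Baire))
    (h : ∀ p x, Represented.IsName p x → ∃ z, Represented.IsName (F p) z ∧ (Q z ↔ ¬ P x)) :
    StrongReducible (decisionProblem P) (decisionProblem Q) := by
  refine strongReducible_iff.2 ⟨_, _, isComputable_negate, hF, fun p x hp _ => ?_⟩
  obtain ⟨z, hz, hQ⟩ := h p x hp
  refine ⟨F p, Part.mem_some _, z, hz, Set.singleton_nonempty _, fun q w hw hq => ?_⟩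
  refine ⟨fun _ => 1 - q 0, Part.mem_some _, 1 - w, ?_, congrArg (1 - ·) hq⟩
  rw [Set.mem_singleton_iff.1 hw]
  by_cases hP : P x <;> simp [decisionProblem, hQ, hP]

/-- The tree of all `σ` no initial segment of which is ruled out by `R`, given the digits of the
parameter `p` up to the same length. -/
def initSegTree (R : List ℕ → List ℕ → Prop) (p : Baire) : Tree :=
  ⟨{σ | ∀ m ≤ σ.length, R (initSeg p m) (σ.take m)}, fun σ n h m hm => by
    simpa [List.take_append_of_le_length hm] using h m (by simp; omega)⟩

theorem mem_initSegTree {R : List ℕ → List ℕ → Prop} {p : Baire} {σ : List ℕ} :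
    σ ∈ initSegTree R p ↔ ∀ m ≤ σ.length, R (initSeg p m) (σ.take m) :=
  Iff.rfl

theorem isPath_initSegTree {R : List ℕ → List ℕ → Prop} {p g : Baire} :
    IsPath (initSegTree R p) g ↔ ∀ m, R (initSeg p m) (initSeg g m) := by
  simp only [IsPath, mem_initSegTree, initSeg_length]
  refine ⟨fun h m => ?_, fun h n m hm => ?_⟩
  · simpa only [take_initSeg g le_rfl] using h m m le_rfl
  · simpa only [take_initSeg g hm] using h m

theorem isComputable_initSegTree {R : List ℕ → List ℕ → Prop} (hR : PrimrecRel R) :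
    ∃ F : Baire → Baire, IsComputable (F : Baire →. Baire) ∧
      ∀ p, Represented.IsName (F p) (initSegTree R p) := by
  let code (n : ℕ) : List ℕ := Denumerable.ofNat (List ℕ) n
  have hcode : Primrec code := Primrec.ofNat _
  have hlen : Primrec fun n => (code n).length := Primrec.list_length.comp hcode
  let D (l : List ℕ) (n : ℕ) : Prop := ∀ m < (code n).length + 1, R (l.take m) ((code n).take m)
  have hD : PrimrecRel D :=
    primrecPred_forall_lt (Primrec.succ.comp (hlen.comp Primrec.snd))
      (hR.comp (Primrec.list_take.comp Primrec.snd (Primrec.fst.comp Primrec.fst))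
        (Primrec.list_take.comp Primrec.snd (hcode.comp (Primrec.snd.comp Primrec.fst))))
  refine ⟨_, isComputable_decideOnInitSeg hD hlen, fun p => isCharFun_decideOnInitSeg fun σ => ?_⟩
  simp only [D, code, Denumerable.ofNat_encode, Nat.lt_succ_iff, SetLike.mem_coe, mem_initSegTree]
  exact forall₂_congr fun m hm => by rw [take_initSeg p hm]

-- The hypothesis `h` is Kleene's normal form of a `Σ¹₁` predicate, so `WF` is `Σ¹₁`-hard.
theorem strongReducible_WF_of_normalForm {X : Type*} [Represented X] {P : X → Prop}
    {R : List ℕ → List ℕ → Prop} (hR : PrimrecRel R)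
    (h : ∀ p x, Represented.IsName p x → (P x ↔ ∃ g, ∀ m, R (initSeg p m) (initSeg g m))) :
    StrongReducible (decisionProblem P) WF := by
  obtain ⟨F, hF, hname⟩ := isComputable_initSegTree hR
  refine strongReducible_decisionProblem_of_iff_not hF fun p x hp => ⟨_, hname p, ?_⟩
  simp only [NoInfinitePath, isPath_initSegTree, h p x hp]

/-- The hypergraph `H` has a proper `k`-coloring. -/
def IsColorable (k : ℕ) (H : CountableHypergraph) : Prop :=
  ∃ f : H.1.vertexSet → Fin k, IsProperColoring H.1 f

/-- `g` codes a proper `k`-coloring of the hypergraph named by `p`: the first component of `g v` is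
the color of `v`, and the second component of `g ⟨j, a⟩` is a vertex of the `j`-th edge whose color
differs from that of its vertex `a`. -/
def IsColoringCode (k : ℕ) (p g : Baire) : Prop :=
  (∀ v, p (Nat.pair 0 v) = 1 → (g v).unpair.1 < k) ∧
  ∀ j a b, p (Nat.pair 1 j) = 1 → p (Nat.pair (j + 2) a) = 1 → p (Nat.pair (j + 2) b) = 1 →
    a ≠ b → p (Nat.pair (j + 2) (g (Nat.pair j a)).unpair.2) = 1 ∧
      (g (g (Nat.pair j a)).unpair.2).unpair.1 ≠ (g a).unpair.1

theorem IsColoringCode.isColorable {k : ℕ} {p g : Baire} {H : CountableHypergraph}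
    (hg : IsColoringCode k p g) (hp : Represented.IsName p H) : IsColorable k H := by
  obtain ⟨J, e, hV, hJ, he, hE⟩ := hp
  obtain ⟨hcolor, hwitness⟩ := hg
  simp only [hV.eq_one_iff, hJ.eq_one_iff, (he _).eq_one_iff] at hcolor hwitness
  refine ⟨fun v => ⟨(g v).unpair.1, hcolor v v.2⟩, fun E hEH hE2 => ?_⟩
  have hsub := H.1.subset_vertexSet_of_mem_edgeSet' hEH
  obtain ⟨j, hj, rfl⟩ := hE ▸ hEH
  obtain ⟨a, ha, b, hb, hab⟩ := hE2
  obtain ⟨hw, hne⟩ := hwitness j a b hj ha hb hab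
  exact ⟨⟨_, hsub hw⟩, ⟨a, hsub ha⟩, hw, ha, fun h => hne (Fin.mk.inj h)⟩

theorem IsColorable.exists_isColoringCode {k : ℕ} {p : Baire} {H : CountableHypergraph}
    (hH : IsColorable k H) (hp : Represented.IsName p H) : ∃ g, IsColoringCode k p g := by
  classical
  obtain ⟨f, hf⟩ := hH
  obtain ⟨J, e, hV, hJ, he, hE⟩ := hp
  let color (v : ℕ) : ℕ := if hv : v ∈ H.1.vertexSet then f ⟨v, hv⟩ else 0
  have color_coe (v : H.1.vertexSet) : color v = f v := by simp [color]
  have hwitness (j a : ℕ) : ∃ w, j ∈ J → (e j).Nontrivial → w ∈ e j ∧ color w ≠ color a := by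
    by_cases h : j ∈ J ∧ (e j).Nontrivial
    · obtain ⟨u, v, hu, hv, huv⟩ := hf (e j) (hE ▸ Set.mem_image_of_mem e h.1) h.2
      have hne : color u ≠ color v := by simpa [color_coe, Fin.val_inj] using huv
      by_cases hua : color u = color a
      · exact ⟨v, fun _ _ => ⟨hv, fun hva => hne (hua.trans hva.symm)⟩⟩
      · exact ⟨u, fun _ _ => ⟨hu, hua⟩⟩
    · exact ⟨0, fun hj he => absurd ⟨hj, he⟩ h⟩
  choose w hw using hwitness
  refine ⟨fun n => Nat.pair (color n) (w n.unpair.1 n.unpair.2), ?_, ?_⟩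
  · simp only [hV.eq_one_iff, Nat.unpair_pair]
    exact fun v hv => color_coe ⟨v, hv⟩ ▸ (f ⟨v, hv⟩).2
  · simp only [hJ.eq_one_iff, (he _).eq_one_iff, Nat.unpair_pair]
    exact fun j a b hj ha hb hab => hw j a hj ⟨a, ha, b, hb, hab⟩

/-- The finite information `l` about a name and `σ` about a coloring code does not contradict
`IsColoringCode`. -/
def IsColoringStage (k : ℕ) (l σ : List ℕ) : Prop :=
  (∀ v < l.length, l[Nat.pair 0 v]? = some 1 → (σ.getD v 0).unpair.1 < k) ∧
  ∀ j < l.length, ∀ a < l.length, ∀ b < l.length, l[Nat.pair 1 j]? = some 1 →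
    l[Nat.pair (j + 2) a]? = some 1 → l[Nat.pair (j + 2) b]? = some 1 → a ≠ b →
    l[Nat.pair (j + 2) (σ.getD (Nat.pair j a) 0).unpair.2]? = none ∨
    l[Nat.pair (j + 2) (σ.getD (Nat.pair j a) 0).unpair.2]? = some 1 ∧
      (σ.getD (σ.getD (Nat.pair j a) 0).unpair.2 0).unpair.1 ≠ (σ.getD a 0).unpair.1

theorem primrecRel_isColoringStage (k : ℕ) : PrimrecRel (IsColoringStage k) := by
  have hlookup {α : Type} [Primcodable α] {l : α → List ℕ} {i j : α → ℕ} (hl : Primrec l)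
      (hi : Primrec i) (hj : Primrec j) : Primrec fun x => (l x)[Nat.pair (i x) (j x)]? :=
    Primrec.list_getElem?.comp hl (Primrec₂.natPair.comp hi hj)
  have hgetD {α : Type} [Primcodable α] {σ : α → List ℕ} {i : α → ℕ} (hσ : Primrec σ)
      (hi : Primrec i) : Primrec fun x => ((σ x).getD (i x) 0).unpair :=
    Primrec.unpair.comp ((Primrec.list_getD 0).comp hσ hi)
  have hlen : Primrec fun x : List ℕ × List ℕ => x.1.length :=
    Primrec.list_length.comp Primrec.fst
  refine PrimrecPred.and (primrecPred_forall_lt hlen ?_) (primrecPred_forall_lt hlen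
    (primrecPred_forall_lt (hlen.comp Primrec.fst)
      (primrecPred_forall_lt (hlen.comp (Primrec.fst.comp Primrec.fst)) ?_)))
  · have hl := Primrec.fst.comp (Primrec.fst (α := List ℕ × List ℕ) (β := ℕ))
    have hσ := Primrec.snd.comp (Primrec.fst (α := List ℕ × List ℕ) (β := ℕ))
    exact primrecPred_imp
      (Primrec.eq.comp (hlookup hl (Primrec.const 0) Primrec.snd) (Primrec.const (some 1)))
      (Primrec.nat_lt.comp (Primrec.fst.comp (hgetD hσ Primrec.snd)) (Primrec.const k))
  · have hb := Primrec.snd (α := ((List ℕ × List ℕ) × ℕ) × ℕ) (β := ℕ)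
    have hja := Primrec.fst (α := ((List ℕ × List ℕ) × ℕ) × ℕ) (β := ℕ)
    have ha := Primrec.snd.comp hja
    have hj := Primrec.snd.comp (Primrec.fst.comp hja)
    have hl := Primrec.fst.comp (Primrec.fst.comp (Primrec.fst.comp hja))
    have hσ := Primrec.snd.comp (Primrec.fst.comp (Primrec.fst.comp hja))
    have hw := Primrec.snd.comp (hgetD hσ (Primrec₂.natPair.comp hj ha))
    have hj2 := Primrec.nat_add.comp hj (Primrec.const 2)
    have hsome : Primrec fun _ : (((List ℕ × List ℕ) × ℕ) × ℕ) × ℕ => some 1 := Primrec.const _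
    refine primrecPred_imp (Primrec.eq.comp (hlookup hl (Primrec.const 1) hj) hsome) ?_
    refine primrecPred_imp (Primrec.eq.comp (hlookup hl hj2 ha) hsome) ?_
    refine primrecPred_imp (Primrec.eq.comp (hlookup hl hj2 hb) hsome) ?_
    refine primrecPred_imp (Primrec.eq.comp ha hb).not ?_
    exact (Primrec.eq.comp (hlookup hl hj2 hw) (Primrec.const none)).or
      ((Primrec.eq.comp (hlookup hl hj2 hw) hsome).and
        (Primrec.eq.comp (Primrec.fst.comp (hgetD hσ hw)) (Primrec.fst.comp (hgetD hσ ha))).not)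

theorem isColoringCode_iff_forall_isColoringStage {k : ℕ} {p g : Baire} :
    IsColoringCode k p g ↔ ∀ m, IsColoringStage k (initSeg p m) (initSeg g m) := by
  simp only [IsColoringStage, getElem?_initSeg_eq_some, initSeg_length, List.getElem?_eq_none_iff]
  refine ⟨fun ⟨hcolor, hwitness⟩ m => ⟨?_, ?_⟩, fun h => ⟨fun v hv => ?_, ?_⟩⟩
  · rintro v hvm ⟨-, hv⟩
    simpa only [getD_initSeg g hvm] using hcolor v hv
  · rintro j - a ham b - ⟨-, hj⟩ ⟨hja, ha⟩ ⟨-, hb⟩ hab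
    have hjam : Nat.pair j a < m := (Nat.pair_lt_pair_left a (by omega)).trans hja
    rw [getD_initSeg g hjam, getD_initSeg g ham, or_iff_not_imp_left, not_le]
    intro hw
    rw [getD_initSeg g ((Nat.right_le_pair _ _).trans_lt hw)]
    exact (hwitness j a b hj ha hb hab).imp_left fun h => ⟨hw, h⟩
  · have hvm : v < Nat.pair 0 v + 1 := Nat.lt_succ_of_le (Nat.right_le_pair 0 v)
    simpa only [getD_initSeg g hvm] using (h _).1 v hvm ⟨Nat.lt_succ_self _, hv⟩
  · intro j a b hj ha hb hab
    set w := (g (Nat.pair j a)).unpair.2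
    let m := Nat.pair 1 j + Nat.pair (j + 2) a + Nat.pair (j + 2) b + Nat.pair (j + 2) w + 1
    have h1 := Nat.right_le_pair 1 j
    have h2 := Nat.right_le_pair (j + 2) a
    have h3 := Nat.right_le_pair (j + 2) b
    have h4 := Nat.right_le_pair (j + 2) w
    have h5 := Nat.pair_lt_pair_left a (show j < j + 2 by omega)
    have hm := (h m).2 j (by omega) a (by omega) b (by omega) ⟨by omega, hj⟩ ⟨by omega, ha⟩
      ⟨by omega, hb⟩ hab
    rw [getD_initSeg g (by omega : Nat.pair j a < m), getD_initSeg g (by omega : w < m),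
      getD_initSeg g (by omega : a < m)] at hm
    obtain hm | ⟨⟨-, hw⟩, hne⟩ := hm
    · change m ≤ Nat.pair (j + 2) w at hm
      omega
    · exact ⟨hw, hne⟩

theorem strongReducible_HPC_WF (k : ℕ) : StrongReducible (HPC k) WF := by
  refine strongReducible_WF_of_normalForm (P := IsColorable k) (primrecRel_isColoringStage k)
    fun p H hp => ?_
  simp only [← isColoringCode_iff_forall_isColoringStage]
  exact ⟨fun hH => hH.exists_isColoringCode hp, fun ⟨_, hg⟩ => hg.isColorable hp⟩

/-! ### From well-foundedness to colorability -/

/-- The vertex standing for the assertion that `σ` lies on a chosen path. -/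
def posLit (K : ℕ) (σ : List ℕ) : ℕ := K + 1 + 2 * encode σ

/-- The vertex standing for the assertion that `σ` does not lie on a chosen path. -/
def negLit (K : ℕ) (σ : List ℕ) : ℕ := K + 2 + 2 * encode σ

theorem posLit_injective (K : ℕ) : Function.Injective (posLit K) := fun σ τ h =>
  encode_injective (by unfold posLit at h; omega)

theorem negLit_injective (K : ℕ) : Function.Injective (negLit K) := fun σ τ h =>
  encode_injective (by unfold negLit at h; omega)

theorem posLit_ne_negLit (K : ℕ) (σ τ : List ℕ) : posLit K σ ≠ negLit K τ := by
  unfold posLit negLit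
  omega

theorem lt_posLit (K : ℕ) (σ : List ℕ) : K < posLit K σ := by
  unfold posLit
  omega

theorem lt_negLit (K : ℕ) (σ : List ℕ) : K < negLit K σ := by
  unfold negLit
  omega

theorem encode_le_posLit (K : ℕ) (σ : List ℕ) : encode σ ≤ posLit K σ := by
  unfold posLit
  omega

/-- The edge expressing that if `σ` lies on the path, so does one of its children in `A`. The color
of the vertex `K` means falsity. -/
def childEdge (K : ℕ) (A : Set (List ℕ)) (σ : List ℕ) : Set ℕ :=
  {v | v = K ∨ v = negLit K σ ∨ ∃ n, σ ++ [n] ∈ A ∧ v = posLit K (σ ++ [n])}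

/-- The edges of the hypergraph that searches for a path through the tree `A`. Each vertex below `K`
is paired with all others and so uses up a color; thus, of `K + 2` colors, two are left for the
other vertices. The edges with `s = K` say that `negLit K σ` negates `posLit K σ`, the edge with
`s = K + 1` says that the empty sequence lies on the path. -/
def pathEdge (K : ℕ) (A : Set (List ℕ)) (s : ℕ) (σ : List ℕ) : Set ℕ :=
  if s < K then {s, encode σ}
  else if s = K then {posLit K σ, negLit K σ}
  else if s = K + 1 then {posLit K [], K}
  else childEdge K A σ

theorem mem_pathEdge_congr {K : ℕ} {A B : Set (List ℕ)} {v : ℕ}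
    (h : ∀ τ, encode τ ≤ v → (τ ∈ A ↔ τ ∈ B)) (s : ℕ) (σ : List ℕ) :
    v ∈ pathEdge K A s σ ↔ v ∈ pathEdge K B s σ := by
  have hchild (n : ℕ) : σ ++ [n] ∈ A ∧ v = posLit K (σ ++ [n]) ↔
      σ ++ [n] ∈ B ∧ v = posLit K (σ ++ [n]) :=
    and_congr_left fun hv => h _ (hv ▸ encode_le_posLit K _)
  simp only [pathEdge]
  split_ifs
  exacts [Iff.rfl, Iff.rfl, Iff.rfl, or_congr_right (or_congr_right (exists_congr hchild))]

/-- The hypergraph that searches for a path through `T`. -/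
def pathHypergraph (K : ℕ) (T : Tree) : CountableHypergraph :=
  ⟨{ vertexSet := Set.univ
     edgeSet := Set.range fun j : ℕ =>
      pathEdge K T j.unpair.1 (Denumerable.ofNat (List ℕ) j.unpair.2)
     subset_vertexSet_of_mem_edgeSet' := fun _ _ => Set.subset_univ _ },
    Set.countable_range _⟩

theorem mem_edgeSet_pathHypergraph {K : ℕ} {T : Tree} {e : Set ℕ} :
    e ∈ (pathHypergraph K T).1.edgeSet ↔ ∃ s σ, pathEdge K T s σ = e := by
  refine ⟨fun ⟨j, hj⟩ => ⟨_, _, hj⟩, fun ⟨s, σ, h⟩ => ⟨Nat.pair s (encode σ), ?_⟩⟩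
  simpa using h

section Computability

variable {α : Type*} [Primcodable α]

theorem primrec_posLit (K : ℕ) : Primrec (posLit K) :=
  Primrec.nat_add.comp (Primrec.const _) (Primrec.nat_mul.comp (Primrec.const 2) Primrec.encode)

theorem primrec_negLit (K : ℕ) : Primrec (negLit K) :=
  Primrec.nat_add.comp (Primrec.const _) (Primrec.nat_mul.comp (Primrec.const 2) Primrec.encode)

theorem primrecPred_exists_child (K : ℕ) {l σ : α → List ℕ} {v : α → ℕ} (hl : Primrec l)
    (hσ : Primrec σ) (hv : Primrec v) : PrimrecPred fun a =>
      ∃ n, (l a)[encode (σ a ++ [n])]? = some 1 ∧ v a = posLit K (σ a ++ [n]) := by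
  let τ (a : α) : List ℕ := Denumerable.ofNat (List ℕ) ((v a - (K + 1)) / 2)
  have hτ : Primrec τ := (Primrec.ofNat _).comp
    (Primrec.nat_div.comp (Primrec.nat_sub.comp hv (Primrec.const _)) (Primrec.const 2))
  have hmem : PrimrecPred fun a => (l a)[encode (τ a)]? = some 1 :=
    Primrec.eq.comp (Primrec.list_getElem?.comp hl (Primrec.encode.comp hτ)) (Primrec.const _)
  have hchild : PrimrecPred fun a => ∃ n ∈ τ a, τ a = σ a ++ [n] := by
    refine (PrimrecRel.exists_mem_list (R := fun n a => τ a = σ a ++ [n]) ?_).comp hτ Primrec.id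
    exact Primrec.eq.comp (hτ.comp Primrec.snd) (Primrec.list_append.comp (hσ.comp Primrec.snd)
      (Primrec.list_cons.comp Primrec.fst (Primrec.const [])))
  refine ((Primrec.eq.comp hv ((primrec_posLit K).comp hτ)).and (hmem.and hchild)).of_eq
    fun a => ⟨?_, ?_⟩
  · rintro ⟨hva, hτa, n, -, hn⟩
    exact ⟨n, hn ▸ hτa, hn ▸ hva⟩
  · rintro ⟨n, hn, hva⟩
    have hτa : τ a = σ a ++ [n] := by
      simp [τ, hva, posLit]
    exact ⟨hτa ▸ hva, hτa ▸ hn, n, by simp [hτa], hτa⟩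

theorem primrecPred_mem_pathEdge (K : ℕ) {l σ : α → List ℕ} {s v : α → ℕ} (hl : Primrec l)
    (hs : Primrec s) (hσ : Primrec σ) (hv : Primrec v) :
    PrimrecPred fun a => v a ∈ pathEdge K {τ | (l a)[encode τ]? = some 1} (s a) (σ a) := by
  have heq {w : α → ℕ} (hw : Primrec w) : PrimrecPred fun a => v a = w a := Primrec.eq.comp hv hw
  have hK : Primrec fun _ : α => K := Primrec.const K
  have hneg : Primrec fun a => negLit K (σ a) := (primrec_negLit K).comp hσ
  have hpos : Primrec fun a => posLit K (σ a) := (primrec_posLit K).comp hσ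
  have hsK : PrimrecPred fun a => s a = K := Primrec.eq.comp hs hK
  have hsK1 : PrimrecPred fun a => s a = K + 1 := Primrec.eq.comp hs (Primrec.const _)
  refine PrimrecPred.of_eq (p := fun a => (s a < K ∧ (v a = s a ∨ v a = encode (σ a))) ∨
    (s a = K ∧ (v a = posLit K (σ a) ∨ v a = negLit K (σ a))) ∨
    (s a = K + 1 ∧ (v a = posLit K [] ∨ v a = K)) ∨
    (K + 1 < s a ∧ (v a = K ∨ v a = negLit K (σ a) ∨
      ∃ n, (l a)[encode (σ a ++ [n])]? = some 1 ∧ v a = posLit K (σ a ++ [n])))) ?_ fun a => ?_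
  · exact ((Primrec.nat_lt.comp hs hK).and ((heq hs).or (heq (Primrec.encode.comp hσ)))).or
      ((hsK.and ((heq hpos).or (heq hneg))).or
      ((hsK1.and ((heq (Primrec.const _)).or (heq hK))).or
      ((Primrec.nat_lt.comp (Primrec.const _) hs).and
        ((heq hK).or ((heq hneg).or (primrecPred_exists_child K hl hσ hv))))))
  · simp only [pathEdge, childEdge]
    split_ifs <;> simp only [Set.mem_insert_iff, Set.mem_singleton_iff, Set.mem_ofPred_eq] <;> grind

end Computability

theorem isComputable_pathHypergraph (K : ℕ) :
    ∃ F : Baire → Baire, IsComputable (F : Baire →. Baire) ∧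
      ∀ p T, Represented.IsName p T → Represented.IsName (F p) (pathHypergraph K T) := by
  let edge (j : ℕ) (A : Set (List ℕ)) : Set ℕ :=
    pathEdge K A j.unpair.1 (Denumerable.ofNat (List ℕ) j.unpair.2)
  let D (l : List ℕ) (n : ℕ) : Prop :=
    n.unpair.1 < 2 ∨ n.unpair.2 ∈ edge (n.unpair.1 - 2) {τ | l[encode τ]? = some 1}
  have hD : PrimrecRel D := by
    have hn := Primrec.unpair.comp (Primrec.snd (α := List ℕ) (β := ℕ))
    have hj := Primrec.unpair.comp (Primrec.nat_sub.comp (Primrec.fst.comp hn) (Primrec.const 2))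
    exact (Primrec.nat_lt.comp (Primrec.fst.comp hn) (Primrec.const 2)).or
      (primrecPred_mem_pathEdge K Primrec.fst (Primrec.fst.comp hj)
        ((Primrec.ofNat _).comp (Primrec.snd.comp hj)) (Primrec.snd.comp hn))
  refine ⟨_, isComputable_decideOnInitSeg hD Primrec.succ, fun p T hp =>
    ⟨Set.univ, fun j => edge j T, ?_, ?_, fun j => ?_, Set.image_univ.symm⟩⟩
  · exact isCharFun_decideOnInitSeg fun v => by simp [D, pathHypergraph]
  · exact isCharFun_decideOnInitSeg fun j => by simp [D]
  · refine isCharFun_decideOnInitSeg fun v => ?_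
    have hD_iff (l : List ℕ) : D l (Nat.pair (j + 2) v) ↔
        v ∈ edge j {τ | l[encode τ]? = some 1} := by
      simp [D]
    refine (hD_iff _).trans (mem_pathEdge_congr (fun τ hτ => ?_) _ _)
    have hlt : encode τ < (Nat.pair (j + 2) v).succ :=
      Nat.lt_succ_of_le (hτ.trans (Nat.right_le_pair _ _))
    rw [Set.mem_ofPred_eq, getElem?_initSeg_eq_some, and_iff_right hlt]
    exact IsCharFun.eq_one_iff hp τ

/-- What the edges of `pathHypergraph K T` demand of a coloring. -/
structure IsPathColoring (K : ℕ) (T : Tree) {k : ℕ} (F : ℕ → Fin k) : Prop where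
  palette : ∀ s < K, ∀ v ≠ s, F v ≠ F s
  literal : ∀ σ, F (posLit K σ) ≠ F (negLit K σ)
  root : F (posLit K []) ≠ F K
  child : ∀ σ, F (negLit K σ) = F K → ∃ n, σ ++ [n] ∈ T ∧ F (posLit K (σ ++ [n])) ≠ F K

section Coloring

variable {K k : ℕ} {T : Tree} {F : ℕ → Fin k}

theorem isColorable_pathHypergraph_iff : IsColorable k (pathHypergraph K T) ↔
    ∃ F : ℕ → Fin k, ∀ s σ, (pathEdge K T s σ).Nontrivial → (F '' pathEdge K T s σ).Nontrivial := by
  constructor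
  · rintro ⟨f, hf⟩
    refine ⟨fun v => f ⟨v, Set.mem_univ v⟩, fun s σ hnt => ?_⟩
    obtain ⟨u, v, hu, hv, huv⟩ := hf _ (mem_edgeSet_pathHypergraph.2 ⟨s, σ, rfl⟩) hnt
    exact ⟨_, Set.mem_image_of_mem _ hu, _, Set.mem_image_of_mem _ hv, huv⟩
  · rintro ⟨F, hF⟩
    refine ⟨fun v => F v, fun e he hnt => ?_⟩
    obtain ⟨s, σ, rfl⟩ := mem_edgeSet_pathHypergraph.1 he
    obtain ⟨_, ⟨u, hu, rfl⟩, _, ⟨v, hv, rfl⟩, huv⟩ := hF s σ hnt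
    exact ⟨⟨u, Set.mem_univ u⟩, ⟨v, Set.mem_univ v⟩, hu, hv, huv⟩

theorem image_pair_nontrivial_iff {a b : ℕ} : (F '' {a, b}).Nontrivial ↔ F a ≠ F b := by
  rw [Set.image_pair]
  exact ⟨fun h hab => by simp [hab] at h, Set.nontrivial_pair⟩

theorem image_childEdge_nontrivial_iff {A : Set (List ℕ)} {σ : List ℕ} :
    (F '' childEdge K A σ).Nontrivial ↔
      (F (negLit K σ) = F K → ∃ n, σ ++ [n] ∈ A ∧ F (posLit K (σ ++ [n])) ≠ F K) := by
  have hK : F K ∈ F '' childEdge K A σ := Set.mem_image_of_mem F (Or.inl rfl)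
  have hmem : (F '' childEdge K A σ).Nontrivial ↔ ∃ v ∈ childEdge K A σ, F v ≠ F K :=
    ⟨fun h => by simpa using h.exists_ne (F K), fun ⟨v, hv, hne⟩ =>
      ⟨_, Set.mem_image_of_mem F hv, _, hK, hne⟩⟩
  refine hmem.trans ⟨?_, fun h => ?_⟩
  · rintro ⟨_, rfl | rfl | ⟨n, hn, rfl⟩, hne⟩ hneg
    exacts [absurd rfl hne, absurd hneg hne, ⟨n, hn, hne⟩]
  · by_cases hneg : F (negLit K σ) = F K
    · obtain ⟨n, hn, hne⟩ := h hneg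
      exact ⟨_, Or.inr (Or.inr ⟨n, hn, rfl⟩), hne⟩
    · exact ⟨_, Or.inr (Or.inl rfl), hneg⟩

theorem isPathColoring_iff : IsPathColoring K T F ↔ ∀ s σ, (pathEdge K T s σ).Nontrivial →
    (F '' pathEdge K T s σ).Nontrivial := by
  constructor
  · intro hF s σ hnt
    unfold pathEdge at hnt ⊢
    split_ifs at hnt ⊢ with hs
    · have hne : encode σ ≠ s := fun h => by simp [h] at hnt
      exact image_pair_nontrivial_iff.2 (hF.palette s hs _ hne).symm
    · exact image_pair_nontrivial_iff.2 (hF.literal σ)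
    · exact image_pair_nontrivial_iff.2 hF.root
    · exact image_childEdge_nontrivial_iff.2 (hF.child σ)
  · intro h
    refine ⟨fun s hs v hv => ?_, fun σ => ?_, ?_, fun σ => ?_⟩
    · have hedge := h s (Denumerable.ofNat (List ℕ) v)
      simp only [pathEdge, if_pos hs, Denumerable.encode_ofNat, image_pair_nontrivial_iff] at hedge
      exact (hedge (Set.nontrivial_pair hv.symm)).symm
    · have hedge := h K σ
      simp only [pathEdge, lt_irrefl, if_false, if_true, image_pair_nontrivial_iff] at hedge
      exact hedge (Set.nontrivial_pair (posLit_ne_negLit K σ σ))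
    · have hedge := h (K + 1) []
      simp only [pathEdge, Nat.not_succ_lt_self, Nat.succ_ne_self, if_false, if_true,
        image_pair_nontrivial_iff] at hedge
      exact hedge (Set.nontrivial_pair (lt_posLit K []).ne')
    · have hedge := h (K + 2) σ
      simp only [pathEdge, show ¬ K + 2 < K by omega, show K + 2 ≠ K by omega,
        show K + 2 ≠ K + 1 by omega, if_false, image_childEdge_nontrivial_iff] at hedge
      exact hedge ⟨K, Or.inl rfl, negLit K σ, Or.inr (Or.inl rfl), (lt_negLit K σ).ne⟩

theorem IsPathColoring.eq_of_ne {F : ℕ → Fin (K + 2)} (hF : IsPathColoring K T F) {a b : ℕ}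
    (ha : K ≤ a) (hb : K ≤ b) (hFa : F a ≠ F K) (hFb : F b ≠ F K) : F a = F b := by
  by_contra hab
  have haK : a ≠ K := ne_of_apply_ne F hFa
  have hbK : b ≠ K := ne_of_apply_ne F hFb
  have hne : a ≠ b := ne_of_apply_ne F hab
  have hcard : (Finset.univ : Finset (Fin (K + 2))).card <
      (insert a (insert b (Finset.range (K + 1)))).card := by
    rw [Finset.card_insert_of_notMem (by simp; omega),
      Finset.card_insert_of_notMem (by simp; omega)]
    simp
  obtain ⟨x, hx, y, hy, hxy, hFxy⟩ :=
    Finset.exists_ne_map_eq_of_card_lt_of_maps_to hcard (f := F) (by simp)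
  have hxK : K ≤ x := not_lt.1 fun h => hF.palette x h y hxy.symm hFxy.symm
  have hyK : K ≤ y := not_lt.1 fun h => hF.palette y h x hxy hFxy
  simp only [Finset.mem_insert, Finset.mem_range] at hx hy
  grind

theorem exists_isPath_of_extendable {Q : List ℕ → Prop} (hnil : Q [])
    (hext : ∀ σ, Q σ → ∃ n, σ ++ [n] ∈ T ∧ Q (σ ++ [n])) : ∃ f, IsPath T f := by
  choose next hT hQ using hext
  let grow (σ : Subtype Q) : Subtype Q := ⟨_, hQ σ.1 σ.2⟩
  let stage (n : ℕ) : Subtype Q := grow^[n] ⟨[], hnil⟩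
  have hstage (n : ℕ) : (stage (n + 1)).1 = (stage n).1 ++ [next _ (stage n).2] :=
    congrArg Subtype.val (Function.iterate_succ_apply' grow n _)
  let f (n : ℕ) : ℕ := next _ (stage n).2
  have hf (n : ℕ) : initSeg f n = (stage n).1 := by
    induction n with
    | zero => rfl
    | succ n ih => rw [initSeg_succ, hstage, ih]
  refine ⟨f, fun n => ?_⟩
  rw [hf]
  exact Descriptive.Tree.mem_of_append (hT _ (stage n).2)

theorem IsPathColoring.exists_isPath {F : ℕ → Fin (K + 2)} (hF : IsPathColoring K T F) :
    ∃ f, IsPath T f :=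
  exists_isPath_of_extendable (Q := fun σ => F (posLit K σ) ≠ F K) hF.root fun σ hσ =>
    hF.child σ <| by_contra fun hneg =>
      hF.literal σ (hF.eq_of_ne (lt_posLit K σ).le (lt_negLit K σ).le hσ hneg)

theorem exists_coloring_of_literals (K : ℕ) (Q : Set (List ℕ)) : ∃ F : ℕ → Fin (K + 2),
    (∀ s < K, ∀ v ≠ s, F v ≠ F s) ∧ (∀ σ, F (posLit K σ) = F K ↔ σ ∉ Q) ∧
      ∀ σ, F (negLit K σ) = F K ↔ σ ∈ Q := by
  classical
  let IsTrue (v : ℕ) : Prop := (∃ σ ∈ Q, posLit K σ = v) ∨ ∃ σ ∉ Q, negLit K σ = v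
  have isTrue_posLit (σ : List ℕ) : IsTrue (posLit K σ) ↔ σ ∈ Q := by
    simp [IsTrue, (posLit_injective K).eq_iff, (posLit_ne_negLit K _ _).symm]
  have isTrue_negLit (σ : List ℕ) : IsTrue (negLit K σ) ↔ σ ∉ Q := by
    simp [IsTrue, (negLit_injective K).eq_iff, posLit_ne_negLit]
  have not_isTrue_of_le {v : ℕ} (hv : v ≤ K) : ¬ IsTrue v := by
    rintro (⟨σ, -, rfl⟩ | ⟨σ, -, rfl⟩)
    exacts [hv.not_gt (lt_posLit K σ), hv.not_gt (lt_negLit K σ)]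
  let F (v : ℕ) : Fin (K + 2) := if IsTrue v then Fin.last _ else ⟨min v K, by omega⟩
  have F_val (v : ℕ) : (F v : ℕ) = if IsTrue v then K + 1 else min v K := by
    simp only [F]
    split_ifs <;> rfl
  have F_eq_iff {v : ℕ} (hv : K ≤ v) : F v = F K ↔ ¬ IsTrue v := by
    rw [Fin.ext_iff, F_val, F_val, if_neg (not_isTrue_of_le le_rfl)]
    split_ifs <;> simp_all
  refine ⟨F, fun s hs v hv => ?_, fun σ => ?_, fun σ => ?_⟩
  · rw [Ne, Fin.ext_iff, F_val, F_val, if_neg (not_isTrue_of_le hs.le)]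
    split_ifs <;> omega
  · rw [F_eq_iff (lt_posLit K σ).le, isTrue_posLit]
  · rw [F_eq_iff (lt_negLit K σ).le, isTrue_negLit, not_not]

theorem IsPath.exists_isPathColoring {f : ℕ → ℕ} (hf : IsPath T f) (K : ℕ) :
    ∃ F : ℕ → Fin (K + 2), IsPathColoring K T F := by
  obtain ⟨F, hpalette, hpos, hneg⟩ := exists_coloring_of_literals K (Set.range (initSeg f))
  refine ⟨F, hpalette, fun σ h => ?_, fun h => (hpos []).1 h ⟨0, rfl⟩, fun σ hσ => ?_⟩
  · have hiff := hpos σ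
    rw [h, hneg] at hiff
    exact iff_not_self hiff
  · obtain ⟨n, rfl⟩ := (hneg σ).1 hσ
    exact ⟨f n, initSeg_succ f n ▸ hf (n + 1), fun h => (hpos _).1 h ⟨n + 1, initSeg_succ f n⟩⟩

end Coloring

theorem strongReducible_WF_HPC (K : ℕ) : StrongReducible WF (HPC (K + 2)) := by
  obtain ⟨F, hF, hname⟩ := isComputable_pathHypergraph K
  refine strongReducible_decisionProblem_of_iff_not (P := NoInfinitePath)
    (Q := IsColorable (K + 2)) hF fun p T hp => ⟨_, hname p T hp, ?_⟩
  simp only [isColorable_pathHypergraph_iff, ← isPathColoring_iff, NoInfinitePath, not_not]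
  exact ⟨fun ⟨_, h⟩ => h.exists_isPath, fun ⟨_, h⟩ => h.exists_isPathColoring K⟩

end Weihrauch

theorem corollary9_general (k : ℕ) (hk : 2 ≤ k) :
    Weihrauch.StrongEquiv Weihrauch.WF (Weihrauch.HPC k) := by
  obtain ⟨K, rfl⟩ := Nat.exists_eq_add_of_le' hk
  exact ⟨Weihrauch.strongReducible_WF_HPC K, Weihrauch.strongReducible_HPC_WF (K + 2)⟩

theorem corollary9 (k : ℕ) (hk : 2 ≤ k) :
    Weihrauch.StrongEquiv (Weihrauch.parallelization Weihrauch.WF)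
      (Weihrauch.parallelization (Weihrauch.HPC k)) :=
  (corollary9_general k hk).parallelization
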